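/- Let $p$ be a prime and let $q>1$ be the smallest prime power with $q\equiv 1\pmod p$. For a finite group $G$, let $\nu_p(G)$ denote the number of Sylow $p$-subgroups of $G$. A Sylow $p$-subgroup $P$ of $G$ is called redundant if every $p$-element of $G$ lies in a Sylow $p$-subgroup of $G$ different from $P$. A finite group is called $p$-solvable if it has a normal series whose quotients are $p$-groups or $p'$-groups. If $G$ is a finite $p$-solvable group with a redundant Sylow $p$-subgroup, then $$\nu_p(G)\ge q^{p+1}.$$ Moreover, this bound is attained: $q^{p+1}$ is the minimum of $\nu_p(G)$ over all finite $p$-solvable groups $G$ with a redundant Sylow $p$-subgroup. -/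

import Mathlib

universe u

/-- A `p`-element of a group: an element whose order is a power of `p`. -/
def IsPElement (p : ℕ) {G : Type u} [Group G] (x : G) : Prop :=
  ∃ k : ℕ, orderOf x = p ^ k

/-- A Sylow `p`-subgroup `P` of `G` is redundant if every `p`-element of `G` lies in a Sylow
`p`-subgroup of `G` different from `P`. -/
def IsRedundantSylow {p : ℕ} {G : Type u} [Group G] (P : Sylow p G) : Prop :=
  ∀ x : G, IsPElement p x → ∃ Q : Sylow p G, Q ≠ P ∧ x ∈ Q

/-- A (finite) group `G` is `p`-solvable if it has a normal series
`1 = H 0 ≤ H 1 ≤ ... ≤ H n = G` (all terms normal in `G`) each of whose quotients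
`H (i + 1) / H i` is a `p`-group or a `p'`-group. Here `(H i).relIndex (H (i + 1))` is the
order of `H (i + 1) / H i`. -/
def IsPSolvable (p : ℕ) (G : Type u) [Group G] : Prop :=
  ∃ (n : ℕ) (H : ℕ → Subgroup G),
    H 0 = ⊥ ∧ H n = ⊤ ∧ (∀ i ≤ n, (H i).Normal) ∧
    ∀ i < n, H i ≤ H (i + 1) ∧
      ((∃ k : ℕ, (H i).relIndex (H (i + 1)) = p ^ k) ∨
        ((H i).relIndex (H (i + 1))).Coprime p)

/-! Lower bound. Choose `M ≤ P` minimal among the subgroups whose only Sylow overgroup is `P`, and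
for `A ≤ M` let `c A` be the number of Sylow `p`-subgroups containing `A`. Then `c ⊤ = 1` and `c ⊥ =
ν_p(G)`. Redundancy makes `M` noncyclic, so `M` has at least `p + 1` maximal subgroups
(`lt_card_coatoms`); they are normal and any two generate `M`. Minimality of `M` gives `c A ≠ 1` for
each of them. The bound follows from two properties of `c`: a value other than `c ⊤` is at least `q
* c ⊤` (`GapBound`), and the product of the values `c A` at the maximal subgroups divides `ν_p(G)`
(`IndependentBound`).

Both properties are proved along a `p`-series (`sylowCount_bounds`). Factoring out a normal
`p`-subgroup leaves `c` unchanged; factoring out a normal `p'`-subgroup `K` changes it by the factor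
`|C_K(A)|`, up to a constant (`exists_sylowCount_mul_eq`). What remains concerns the coprime action
of `M` on `K`. Invariant Sylow subgroups reduce `IndependentBound` to `r`-groups, and central
quotients reduce it to abelian groups, where the fixed subgroups are independent modulo `C_V(M)`.
`GapBound` comes from counting fixed points modulo `p` in an invariant Sylow `r`-subgroup.

Sharpness. Let `C_p × C_p` act diagonally on `F_q^(p+1)` through its `p + 1` nontrivial characters
up to proportionality. Every element lies in the kernel of one of them, which gives redundancy. -/

/-- The subgroup of elements of `K` fixed by every element of `A`. -/
def fixedSubgroup {M : Type*} (K : Type*) [Group M] [Group K] [MulDistribMulAction M K]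
    (A : Subgroup M) : Subgroup K where
  carrier := {k | ∀ a ∈ A, a • k = k}
  mul_mem' {x y} hx hy a ha := by rw [smul_mul', hx a ha, hy a ha]
  one_mem' a _ := smul_one a
  inv_mem' {x} hx a ha := by rw [smul_inv', hx a ha]

/-! ### Fixed points of coprime actions -/

section Fixed

variable {M K : Type*} [Group M] [Group K] [MulDistribMulAction M K]

lemma mem_fixedSubgroup {A : Subgroup M} {k : K} :
    k ∈ fixedSubgroup K A ↔ ∀ a ∈ A, a • k = k := Iff.rfl

lemma fixedSubgroup_anti {A B : Subgroup M} (h : A ≤ B) :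
    fixedSubgroup K B ≤ fixedSubgroup K A := fun _ hk a ha => hk a (h ha)

lemma fixedSubgroup_inf_sup (A B : Subgroup M) {k : K} (hA : k ∈ fixedSubgroup K A)
    (hB : k ∈ fixedSubgroup K B) : k ∈ fixedSubgroup K (A ⊔ B) := by
  have : A ⊔ B ≤ MulAction.stabilizer M k := sup_le (fun a ha => hA a ha) (fun a ha => hB a ha)
  exact fun a ha => this ha

lemma fixedSubgroup_bot : fixedSubgroup K (⊥ : Subgroup M) = ⊤ := by
  ext k
  simp only [mem_fixedSubgroup, Subgroup.mem_bot, Subgroup.mem_top, iff_true]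
  rintro a rfl
  exact one_smul M k

/-- A `p`-group `A` acting on a set `K` fixes a point of each invariant subset whose cardinality
is prime to `p`. -/
lemma exists_fixed_mem {p : ℕ} [Fact p.Prime] {A : Subgroup M} (hA : IsPGroup p A) [Finite K]
    (X : Set K) (hX : ∀ a ∈ A, ∀ x ∈ X, a • x ∈ X) (hc : ¬ p ∣ Nat.card X) :
    ∃ x ∈ X, x ∈ fixedSubgroup K A := by
  let _ : MulAction A X :=
    { smul := fun a x => ⟨(a : M) • (x : K), hX a a.2 x x.2⟩
      one_smul := fun x => Subtype.ext (one_smul M (x : K))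
      mul_smul := fun a b x => Subtype.ext (mul_smul (a : M) (b : M) (x : K)) }
  obtain ⟨x, hx⟩ := hA.nonempty_fixed_point_of_prime_not_dvd_card X hc
  exact ⟨x, x.2, fun a ha => congrArg Subtype.val (hx ⟨a, ha⟩)⟩

lemma card_fixedSubgroup_modEq {p : ℕ} [Fact p.Prime] {A : Subgroup M} (hA : IsPGroup p A)
    [Finite K] : Nat.card K ≡ Nat.card (fixedSubgroup K A) [MOD p] := by
  have h := hA.card_modEq_card_fixedPoints K
  have e : Nat.card (MulAction.fixedPoints A K) = Nat.card (fixedSubgroup K A) :=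
    Nat.card_congr (Equiv.setCongr (by
      ext k
      exact ⟨fun hk a ha => hk ⟨a, ha⟩, fun hk a => hk a a.2⟩))
  rwa [e] at h

/-- The action on an invariant subgroup. -/
@[reducible] def restrictedAction (M : Type*) [Group M] [MulDistribMulAction M K] (H : Subgroup K)
    (hH : ∀ (m : M), ∀ k ∈ H, m • k ∈ H) : MulDistribMulAction M H where
  smul m k := ⟨m • (k : K), hH m k k.2⟩
  one_smul k := Subtype.ext (one_smul M (k : K))
  mul_smul a b k := Subtype.ext (mul_smul a b (k : K))
  smul_mul m a b := Subtype.ext (smul_mul' m (a : K) (b : K))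
  smul_one m := Subtype.ext (smul_one m)

lemma card_fixedSubgroup_restricted (H : Subgroup K)
    (hH : ∀ (m : M), ∀ k ∈ H, m • k ∈ H) (A : Subgroup M) :
    letI := restrictedAction M H hH
    Nat.card (fixedSubgroup H A) = Nat.card (H ⊓ fixedSubgroup K A : Subgroup K) := by
  let := restrictedAction M H hH
  refine Nat.card_congr
    { toFun := fun k => ⟨k.1.1, k.1.2, fun a ha => congrArg Subtype.val (k.2 a ha)⟩
      invFun := fun k => ⟨⟨k.1, k.2.1⟩, fun a ha => Subtype.ext (k.2.2 a ha)⟩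
      left_inv := fun _ => rfl
      right_inv := fun _ => rfl }

/-- The action on the quotient by an invariant normal subgroup. -/
@[reducible] def quotientAction (M : Type*) [Group M] [MulDistribMulAction M K] (Z : Subgroup K)
    [Z.Normal] (hZ : ∀ (m : M), ∀ k ∈ Z, m • k ∈ Z) : MulDistribMulAction M (K ⧸ Z) where
  smul m := QuotientGroup.map Z Z (MulDistribMulAction.toMonoidHom K m) (fun k hk => hZ m k hk)
  one_smul x := by
    induction x using QuotientGroup.induction_on with
    | H k => exact congrArg (QuotientGroup.mk (s := Z)) (one_smul M k)
  mul_smul a b x := by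
    induction x using QuotientGroup.induction_on with
    | H k => exact congrArg (QuotientGroup.mk (s := Z)) (mul_smul a b k)
  smul_mul m a b := map_mul (QuotientGroup.map Z Z (MulDistribMulAction.toMonoidHom K m) _) a b
  smul_one m := map_one (QuotientGroup.map Z Z (MulDistribMulAction.toMonoidHom K m) _)

/-- In a coprime action the fixed points of a quotient are covered by fixed points. -/
lemma card_fixedSubgroup_quotient {p : ℕ} [Fact p.Prime] [Finite K] (Z : Subgroup K)
    [Z.Normal] (hZ : ∀ (m : M), ∀ k ∈ Z, m • k ∈ Z) (hp : ¬ p ∣ Nat.card K)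
    {A : Subgroup M} (hA : IsPGroup p A) :
    letI := quotientAction M Z hZ
    Nat.card (fixedSubgroup K A) =
      Nat.card (Z ⊓ fixedSubgroup K A : Subgroup K) * Nat.card (fixedSubgroup (K ⧸ Z) A) := by
  let := quotientAction M Z hZ
  have hsmul : ∀ (m : M) (k : K), m • (k : K ⧸ Z) = ((m • k : K) : K ⧸ Z) := fun _ _ => rfl
  have hmap : (fixedSubgroup K A).map (QuotientGroup.mk' Z) = fixedSubgroup (K ⧸ Z) A := by
    ext x
    constructor
    · rintro ⟨k, hk, rfl⟩ a ha
      change a • (k : K ⧸ Z) = k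
      rw [hsmul, hk a ha]
    · induction x using QuotientGroup.induction_on with | H k => ?_
      intro hk
      obtain ⟨x, hx, hxf⟩ := exists_fixed_mem hA (K := K)
        ((QuotientGroup.mk : K → K ⧸ Z) ⁻¹' {(k : K ⧸ Z)})
        (fun a ha x hx => by
          simp only [Set.mem_preimage, Set.mem_singleton_iff] at hx ⊢
          rw [← hsmul, hx, hk a ha])
        -- The coset to be hit has `|Z|` elements, a number prime to `p`.
        (by
          have h := QuotientGroup.card_preimage_mk Z {(k : K ⧸ Z)}
          rw [h]
          simp only [Nat.card_unique, mul_one]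
          exact fun h => hp (h.trans Z.card_subgroup_dvd_card))
      exact ⟨x, hxf, hx⟩
  rw [← hmap, ← Subgroup.relIndex_ker, QuotientGroup.ker_mk', ← Subgroup.inf_relIndex_right,
    ← Subgroup.relIndex_bot_left, ← Subgroup.relIndex_bot_left,
    Subgroup.relIndex_mul_relIndex _ _ _ bot_le inf_le_right]

end Fixed

/-! ### The independence property -/

/-- The values of `c` at normal subgroups that generate `M` in pairs are independent. -/
def IndependentBound {M : Type*} [Group M] (c : Subgroup M → ℕ) : Prop :=
  ∀ I : Finset (Subgroup M), (∀ A ∈ I, A.Normal) →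
    (∀ A ∈ I, ∀ B ∈ I, A ≠ B → A ⊔ B = ⊤) →
    (∏ A ∈ I, c A) * c ⊤ ∣ c ⊥ * c ⊤ ^ I.card

/-- For `c ⊤ ≠ 0` the property says that the product of the ratios `c A / c ⊤` divides `c ⊥ / c ⊤`.
It therefore passes to products, and constant factors cancel, which allows working one factor of a
series at a time. -/
lemma IndependentBound.mul {M : Type*} [Group M] {c d : Subgroup M → ℕ} (hc : IndependentBound c)
    (hd : IndependentBound d) : IndependentBound fun A => c A * d A := by
  intro I hn hs
  have h := mul_dvd_mul (hc I hn hs) (hd I hn hs)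
  simp only [Finset.prod_mul_distrib, mul_pow]
  refine (dvd_of_eq ?_).trans (h.trans (dvd_of_eq ?_)) <;> ring

lemma IndependentBound.of_mul_right {M : Type*} [Group M] {c : Subgroup M → ℕ} {d : ℕ} (hd : d ≠ 0)
    (h : IndependentBound fun A => c A * d) : IndependentBound c := by
  intro I hn hs
  have h := h I hn hs
  simp only [Finset.prod_mul_distrib, Finset.prod_const, mul_pow] at h
  refine Nat.dvd_of_mul_dvd_mul_right (Nat.pos_of_ne_zero (pow_ne_zero (I.card + 1) hd)) ?_
  convert h using 1 <;> ring

/-! ### Independence for abelian groups and `r`-groups -/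

section Abelian

variable {M V : Type*} [Group M]

/-- The product over the `B`-translates of an element. -/
noncomputable def translateProd [CommGroup V] [MulDistribMulAction M V] (B : Subgroup M)
    [Fintype B] : V →* V where
  toFun v := ∏ b : B, (b : M) • v
  map_one' := by simp
  map_mul' v w := by simp [Finset.prod_mul_distrib]

/-- Elements of `A` permute the `B`-translates of `v` because `B` is normal and `A` fixes `v`;
elements of `B` permute them by translation. -/
lemma translateProd_mem [CommGroup V] [MulDistribMulAction M V] {A B : Subgroup M} [Fintype B]
    (hB : B.Normal) (h : A ⊔ B = ⊤) {v : V} (hv : v ∈ fixedSubgroup V A) :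
    translateProd B v ∈ fixedSubgroup V (⊤ : Subgroup M) := by
  rw [← h]
  apply fixedSubgroup_inf_sup
  · intro a ha
    change a • ∏ b : B, (b : M) • v = ∏ b : B, (b : M) • v
    rw [Finset.smul_prod']
    refine Fintype.prod_equiv (MulAut.conjNormal a).toEquiv _ _ fun b => ?_
    simp only [MulEquiv.toEquiv_eq_coe, EquivLike.coe_coe, MulAut.conjNormal_apply, smul_smul]
    conv_rhs => rw [← hv a ha]
    simp [smul_smul]
  · intro a ha
    change a • ∏ b : B, (b : M) • v = ∏ b : B, (b : M) • v
    rw [Finset.smul_prod']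
    refine Fintype.prod_equiv (Equiv.mulLeft (⟨a, ha⟩ : B)) _ _ fun b => ?_
    simp [smul_smul]

lemma translateProd_of_fixed [CommGroup V] [MulDistribMulAction M V] {B : Subgroup M} [Fintype B]
    {v : V} (hv : v ∈ fixedSubgroup V B) : translateProd B v = v ^ Nat.card B := by
  change ∏ b : B, (b : M) • v = _
  rw [Finset.prod_congr rfl fun (b : B) _ => hv b b.2]
  simp

lemma independentBound_of_commGroup {p : ℕ} [Fact p.Prime] [Finite M] (hM : IsPGroup p M)
    [CommGroup V] [MulDistribMulAction M V] [Finite V] (hp : ¬ p ∣ Nat.card V) :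
    IndependentBound fun A : Subgroup M => Nat.card (fixedSubgroup V A) := by
  classical
  intro I hn hs
  set F : Subgroup V := fixedSubgroup V (⊤ : Subgroup M)
  -- The subgroups `C_V(A) / F` form a direct product inside `V / F`; this is the resulting count.
  have key : ∀ J ⊆ I, (∏ A ∈ J, Nat.card (fixedSubgroup V A)) * Nat.card F =
      Nat.card (F ⊔ J.sup (fun A => fixedSubgroup V A) : Subgroup V) * Nat.card F ^ J.card := by
    intro J
    induction J using Finset.induction_on with
    | empty => simp
    | insert B J hBJ ih =>
      intro hJ
      have hBI := hJ (Finset.mem_insert_self B J)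
      have ih := ih ((Finset.subset_insert B J).trans hJ)
      set H : Subgroup V := F ⊔ J.sup (fun A => fixedSubgroup V A)
      have hFB : F ≤ fixedSubgroup V B := fixedSubgroup_anti le_top
      let _ := Fintype.ofFinite B
      have hH : H ≤ F.comap (translateProd B) := by
        refine sup_le (fun v hv => ?_) (Finset.sup_le fun A hA v hv => ?_)
        · exact translateProd_mem (hn B hBI) (top_sup_eq B) hv
        · exact translateProd_mem (hn B hBI) (hs A (hJ (Finset.mem_insert_of_mem hA)) B hBI
            (fun h => hBJ (h ▸ hA))) hv
      -- The translate product sends `H` into `F`, yet on `C_V(B)` it is the power map with exponent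
      -- `|B|`, which is invertible because `|B|` is prime to `|V|`.
      have hinf : H ⊓ fixedSubgroup V B = F := by
        refine le_antisymm (fun v hv => ?_) (le_inf le_sup_left hFB)
        have h1 : v ^ Nat.card B ∈ F := by
          rw [← translateProd_of_fixed hv.2]
          exact hH hv.1
        obtain ⟨n, hn⟩ := (IsPGroup.iff_card.mp (hM.to_subgroup B))
        have hcop : (Nat.card V).Coprime (Nat.card B) := by
          rw [hn]
          exact (Nat.Coprime.pow_left n (((Fact.out : p.Prime).coprime_iff_not_dvd).2 hp)).symm
        obtain ⟨m, hm⟩ := exists_pow_eq_self_of_coprime (x := v) (n := Nat.card B)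
          (hcop.symm.coprime_dvd_right (orderOf_dvd_natCard v))
        rw [← hm]
        exact F.pow_mem h1 m
      have hsup : F ⊔ (insert B J).sup (fun A => fixedSubgroup V A) = fixedSubgroup V B ⊔ H := by
        rw [Finset.sup_insert, sup_left_comm]
      have hcard : Nat.card (fixedSubgroup V B ⊔ H : Subgroup V) * Nat.card F =
          Nat.card H * Nat.card (fixedSubgroup V B) := by
        have e1 := Subgroup.relIndex_mul_relIndex ⊥ H (fixedSubgroup V B ⊔ H) bot_le le_sup_right
        have e2 := Subgroup.relIndex_mul_relIndex ⊥ F (fixedSubgroup V B) bot_le hFB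
        rw [Subgroup.relIndex_sup_right, ← Subgroup.inf_relIndex_right H, hinf,
          Subgroup.relIndex_bot_left, Subgroup.relIndex_bot_left] at e1
        rw [Subgroup.relIndex_bot_left, Subgroup.relIndex_bot_left] at e2
        rw [← e1, ← e2]
        ring
      rw [Finset.prod_insert hBJ, Finset.card_insert_of_notMem hBJ, hsup, mul_assoc, ih, pow_succ',
        ← mul_assoc, ← mul_assoc, hcard]
      ring
  dsimp only
  rw [key I subset_rfl, fixedSubgroup_bot, Subgroup.card_top]
  exact mul_dvd_mul_right (Subgroup.card_subgroup_dvd_card _) _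

end Abelian

/-- Induction on the order: the centre is nontrivial, characteristic and abelian, and fixed points
of a coprime action are multiplicative along it. -/
lemma independentBound_of_isPGroup {M : Type*} [Group M] {p : ℕ} [Fact p.Prime] [Finite M]
    (hM : IsPGroup p M) {r : ℕ} [Fact r.Prime] :
    ∀ (n : ℕ) (R : Type*) [Group R] [MulDistribMulAction M R] [Finite R], Nat.card R ≤ n →
      IsPGroup r R → ¬ p ∣ Nat.card R →
      IndependentBound fun A : Subgroup M => Nat.card (fixedSubgroup R A) := by
  intro n
  induction n with
  | zero => intro R _ _ _ h; exact absurd (Nat.le_zero.mp h) Nat.card_pos.ne'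
  | succ n ih =>
    intro R _ _ _ hn hR hp
    rcases subsingleton_or_nontrivial R with hs | hs
    · intro I _ _
      simp [Nat.card_unique]
    set Z := Subgroup.center R with hZdef
    have hZ : ∀ (m : M), ∀ k ∈ Z, m • k ∈ Z := by
      intro m k hk
      rw [hZdef, Subgroup.mem_center_iff] at hk ⊢
      intro g
      have := congrArg (m • ·) (hk (m⁻¹ • g))
      simpa [smul_mul'] using this
    have h1 : IndependentBound fun A : Subgroup M =>
        Nat.card (Z ⊓ fixedSubgroup R A : Subgroup R) := by
      let _ : CommGroup Z := { (inferInstance : Group Z) with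
        mul_comm := fun a b => Subtype.ext ((Subgroup.mem_center_iff.mp b.2 a)) }
      let _ : MulDistribMulAction M Z := restrictedAction M Z hZ
      have h := independentBound_of_commGroup hM (V := Z)
        (fun h => hp (h.trans Z.card_subgroup_dvd_card))
      have e : (fun A : Subgroup M => Nat.card (Z ⊓ fixedSubgroup R A : Subgroup R)) =
          fun A => Nat.card (fixedSubgroup Z A) :=
        funext fun A => (card_fixedSubgroup_restricted Z hZ A).symm
      rw [e]
      exact h
    have hZ1 : Z ≠ ⊥ := hR.bot_lt_center.ne'
    have hdvd : Nat.card (R ⧸ Z) ∣ Nat.card R := Subgroup.card_quotient_dvd_card Z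
    have hlt : Nat.card (R ⧸ Z) < Nat.card R := by
      have := Subgroup.card_mul_index Z
      have h1 : 1 < Nat.card Z := (Subgroup.one_lt_card_iff_ne_bot Z).mpr hZ1
      rw [← this]
      exact lt_mul_left (Nat.card_pos (α := R ⧸ Z)) h1
    let _ := quotientAction M Z hZ
    have h2 := ih (R ⧸ Z) (by omega) (hR.to_quotient Z) (fun h => hp (h.trans hdvd))
    have h3 := h1.mul h2
    have e : (fun A : Subgroup M => Nat.card (fixedSubgroup R A)) = fun A =>
        Nat.card (Z ⊓ fixedSubgroup R A : Subgroup R) * Nat.card (fixedSubgroup (R ⧸ Z) A) :=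
      funext fun A => card_fixedSubgroup_quotient Z hZ hp (hM.to_subgroup A)
    rw [e]
    exact h3

/-! ### Invariant Sylow subgroups of coprime actions -/

section Coprime

variable {M K : Type*} [Group M] [Group K] [MulDistribMulAction M K]

open scoped Pointwise in
lemma smul_sylow_smul {r : ℕ} (a : M) (k : K) (R : Sylow r K) :
    a • (k • R) = (a • k) • (a • R) := by
  refine Sylow.ext ?_
  simp only [Sylow.smul_def, Sylow.pointwise_smul_def]
  ext x
  simp [Subgroup.mem_pointwise_smul_iff_inv_smul_mem, smul_mul', MulAut.smul_def]

lemma exists_invariant_sylow {p : ℕ} [Fact p.Prime] (hM : IsPGroup p M) [Finite K]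
    (hp : ¬ p ∣ Nat.card K) (r : ℕ) [Fact r.Prime] : ∃ R : Sylow r K, ∀ m : M, m • R = R := by
  have h : ¬ p ∣ Nat.card (Sylow r K) := fun h =>
    hp (h.trans ((default : Sylow r K).card_dvd_index.trans (Subgroup.index_dvd_card _)))
  obtain ⟨R, hR⟩ := hM.nonempty_fixed_point_of_prime_not_dvd_card (Sylow r K) h
  exact ⟨R, hR⟩

/-- Glauberman's argument: the elements carrying `R` to `R'` form an `A`-invariant coset of a
stabilizer, so their number is prime to `p` and `A` fixes one of them. -/
lemma exists_fixed_smul_sylow_eq {p : ℕ} [Fact p.Prime] [Finite K] (hp : ¬ p ∣ Nat.card K) {r : ℕ}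
    [Fact r.Prime] {A : Subgroup M} (hA : IsPGroup p A) {R R' : Sylow r K}
    (hR : ∀ a ∈ A, a • R = R) (hR' : ∀ a ∈ A, a • R' = R') :
    ∃ c ∈ fixedSubgroup K A, c • R = R' := by
  obtain ⟨k, hk⟩ := MulAction.exists_smul_eq K R R'
  obtain ⟨c, hc, hcf⟩ := exists_fixed_mem hA {x : K | x • R = R'}
    (fun a ha x hx => by
      have := smul_sylow_smul a x R
      rw [hR a ha, hx, hR' a ha] at this
      exact this.symm)
    (by
      have e : {x : K | x • R = R'} ≃ MulAction.stabilizer K R :=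
        { toFun := fun x => ⟨k⁻¹ * x, by
            rw [MulAction.mem_stabilizer_iff, mul_smul, x.2, ← hk, inv_smul_smul]⟩
          invFun := fun x => ⟨k * x, by
            rw [Set.mem_ofPred_eq, mul_smul, x.2, hk]⟩
          left_inv := fun x => by simp
          right_inv := fun x => by simp }
      rw [Nat.card_congr e]
      exact fun h => hp (h.trans (Subgroup.card_subgroup_dvd_card _)))
  exact ⟨c, hcf, hc⟩

open scoped Pointwise in
lemma sylow_smul_eq_of_mem {r : ℕ} [Finite K] {R : Sylow r K} {m : M}
    (h : ∀ k ∈ R, m • k ∈ R) : m • R = R := by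
  refine Sylow.ext ?_
  rw [Sylow.pointwise_smul_def]
  refine Subgroup.eq_of_le_of_card_ge ?_ ?_
  · intro x hx
    rw [Subgroup.mem_smul_pointwise_iff_exists] at hx
    obtain ⟨k, hk, rfl⟩ := hx
    exact h k hk
  · rw [Nat.card_congr (Subgroup.equivSMul m (R : Subgroup K)).toEquiv]

open scoped Pointwise in
lemma smul_mem_of_sylow_smul_eq {r : ℕ} {R : Sylow r K} {m : M} (h : m • R = R) {k : K}
    (hk : k ∈ R) : m • k ∈ R := by
  have : m • k ∈ m • (R : Subgroup K) := Subgroup.smul_mem_pointwise_smul _ _ _ hk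
  rw [← Sylow.pointwise_smul_def, h] at this
  exact this

/-- An invariant `r`-subgroup is contained in an invariant Sylow `r`-subgroup. -/
lemma exists_invariant_sylow_ge {p : ℕ} [Fact p.Prime] (hM : IsPGroup p M) [Finite K]
    (hp : ¬ p ∣ Nat.card K) {r : ℕ} [Fact r.Prime] {S : Subgroup K} (hS : IsPGroup r S)
    (hinv : ∀ (m : M), ∀ k ∈ S, m • k ∈ S) :
    ∃ R : Sylow r K, (∀ m : M, m • R = R) ∧ S ≤ R := by
  obtain ⟨T, hST, hT⟩ := (Set.toFinite
    {T : Subgroup K | IsPGroup r T ∧ ∀ (m : M), ∀ k ∈ T, m • k ∈ T}).exists_le_maximal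
      (show S ∈ _ from ⟨hS, hinv⟩)
  obtain ⟨⟨hTr, hTinv⟩, hmax⟩ := hT
  -- An invariant Sylow subgroup of the normalizer contains `T`, hence equals it by maximality. A
  -- `p`-group-style normalizer count for the prime `r` then makes `T` Sylow in `K`.
  set N : Subgroup K := Subgroup.normalizer T with hN
  have hNinv : ∀ (m : M), ∀ k ∈ N, m • k ∈ N := by
    intro m k hk
    have hTiff : ∀ x, m • x ∈ T ↔ x ∈ T := fun x =>
      ⟨fun h => by simpa using hTinv m⁻¹ _ h, hTinv m x⟩
    rw [hN, Subgroup.mem_normalizer_iff] at hk ⊢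
    intro h
    have := hk (m⁻¹ • h)
    rw [← hTiff, ← hTiff (k * _ * _)] at this
    simpa [smul_mul'] using this
  let _ := restrictedAction M N hNinv
  obtain ⟨U, hU⟩ := exists_invariant_sylow hM (K := N)
    (fun h => hp (h.trans N.card_subgroup_dvd_card)) r
  have hTN : T ≤ N := Subgroup.le_normalizer
  have : (T.subgroupOf N).Normal := Subgroup.normal_in_normalizer
  have hTU : T.subgroupOf N ≤ U := 
    (show IsPGroup r (T.subgroupOf N) from hTr.comap_subtype).le_sylow_of_normal U
  have hle : T ≤ (U : Subgroup N).map N.subtype := by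
    intro x hx
    exact ⟨⟨x, hTN hx⟩, hTU hx, rfl⟩
  have hge : (U : Subgroup N).map N.subtype ≤ T := by
    refine hmax ⟨U.isPGroup'.map _, ?_⟩ hle
    rintro m _ ⟨x, hx, rfl⟩
    exact ⟨m • x, smul_mem_of_sylow_smul_eq (hU m) hx, rfl⟩
  have hUT : (U : Subgroup N) = T.subgroupOf N :=
    le_antisymm (fun x hx => hge ⟨x, hx, rfl⟩) hTU
  obtain ⟨n, hn⟩ := IsPGroup.iff_card.mp hTr
  have hidx : ¬ r ∣ T.index := by
    have h1 := U.not_dvd_index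
    rw [hUT] at h1
    have h2 := Sylow.card_quotient_normalizer_modEq_card_quotient hn
    exact fun h => h1 ((h2.dvd_iff dvd_rfl).mpr h)
  refine ⟨hTr.toSylow hidx, fun m => sylow_smul_eq_of_mem fun k hk => ?_, ?_⟩
  · exact hTinv m k hk
  · exact hST

/-- An invariant Sylow subgroup of a coprime action meets the fixed points of every
subgroup `A` in a Sylow subgroup of the fixed points of `A`. -/
lemma card_sylow_inf_fixedSubgroup {p : ℕ} [Fact p.Prime] (hM : IsPGroup p M) [Finite K]
    (hp : ¬ p ∣ Nat.card K) {r : ℕ} [Fact r.Prime] {R : Sylow r K} (hR : ∀ m : M, m • R = R)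
    (A : Subgroup M) :
    Nat.card ((R : Subgroup K) ⊓ fixedSubgroup K A : Subgroup K) =
      r ^ (Nat.card (fixedSubgroup K A)).factorization r := by
  set F := fixedSubgroup K A
  have hA := hM.to_subgroup A
  let S : Sylow r F := default
  obtain ⟨R', hR', hSR'⟩ := exists_invariant_sylow_ge (M := A) hA hp
    (S.isPGroup'.map F.subtype) (by
      rintro a _ ⟨x, hx, rfl⟩
      have : a • (x : K) = x := x.2 a a.2
      refine ⟨x, hx, this.symm⟩)
  -- Conjugation by the fixed element `c` preserves `F` and moves the Sylow subgroup `S` of `F` into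
  -- `R`.
  obtain ⟨c, hc, hcR⟩ := exists_fixed_smul_sylow_eq hp hA (R := R') (R' := R)
    (fun a ha => hR' ⟨a, ha⟩) (fun a _ => hR a)
  have hle : Nat.card S ≤ Nat.card ((R : Subgroup K) ⊓ F : Subgroup K) := by
    refine Nat.card_le_card_of_injective
      (fun s : S => (⟨c * (s : F) * c⁻¹, ?_, ?_⟩ : ((R : Subgroup K) ⊓ F : Subgroup K))) ?_
    · rw [← hcR]
      have : ((s : F) : K) ∈ R' := hSR' ⟨s, s.2, rfl⟩
      exact Subgroup.smul_mem_pointwise_smul _ (MulAut.conj c) (R' : Subgroup K) this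
    · exact F.mul_mem (F.mul_mem hc (s : F).2) (F.inv_mem hc)
    · intro s t h
      exact Subtype.ext (Subtype.ext
        (mul_left_cancel (mul_right_cancel (congrArg Subtype.val h))))
  rw [Sylow.card_eq_multiplicity] at hle
  refine le_antisymm ?_ hle
  have hpg : IsPGroup r ((R : Subgroup K) ⊓ F : Subgroup K) := R.isPGroup'.to_inf_left
  obtain ⟨n, hn⟩ := IsPGroup.iff_card.mp hpg
  rw [hn]
  refine Nat.pow_le_pow_right (Fact.out : r.Prime).pos ?_
  refine ((Fact.out : r.Prime).pow_dvd_iff_le_factorization Nat.card_pos.ne').mp ?_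
  rw [← hn]
  exact Subgroup.card_dvd_of_le inf_le_right

/-- Divisibility is checked one prime `r` at a time: an invariant Sylow `r`-subgroup sees exactly
the `r`-part of every `|C_K(A)|`. -/
lemma independentBound_of_coprime {p : ℕ} [Fact p.Prime] [Finite M] (hM : IsPGroup p M) [Finite K]
    (hp : ¬ p ∣ Nat.card K) :
    IndependentBound fun A : Subgroup M => Nat.card (fixedSubgroup K A) := by
  intro I hn hs
  have hne : ∀ A : Subgroup M, Nat.card (fixedSubgroup K A) ≠ 0 := fun A => Nat.card_pos.ne'
  have h0 : ∏ A ∈ I, Nat.card (fixedSubgroup K A) ≠ 0 := Finset.prod_ne_zero_iff.mpr fun A _ => hne A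
  rw [← Nat.factorization_le_iff_dvd (mul_ne_zero h0 (hne _))
    (mul_ne_zero (hne _) (pow_ne_zero _ (hne _)))]
  intro r
  by_cases hr : r.Prime
  swap
  · simp [Nat.factorization_eq_zero_of_not_prime _ hr]
  have : Fact r.Prime := ⟨hr⟩
  obtain ⟨R, hR⟩ := exists_invariant_sylow hM hp r
  have hinv : ∀ (m : M), ∀ k ∈ (R : Subgroup K), m • k ∈ (R : Subgroup K) :=
    fun m k hk => smul_mem_of_sylow_smul_eq (hR m) hk
  let _ := restrictedAction M (R : Subgroup K) hinv
  have h := independentBound_of_isPGroup hM _ (R : Subgroup K) le_rfl R.isPGroup'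
    (fun h => hp (h.trans (Subgroup.card_subgroup_dvd_card _))) I hn hs
  simp only [card_fixedSubgroup_restricted (R : Subgroup K) hinv,
    card_sylow_inf_fixedSubgroup hM hp hR, Finset.prod_pow_eq_pow_sum, ← pow_mul, ← pow_add] at h
  rw [Nat.pow_dvd_pow_iff_le_right hr.one_lt] at h
  rw [Nat.factorization_mul h0 (hne _), Nat.factorization_mul (hne _) (pow_ne_zero _ (hne _)),
    Nat.factorization_prod fun A _ => hne A, Nat.factorization_pow]
  simp only [Finsupp.coe_add, Pi.add_apply, Finsupp.coe_smul, Pi.smul_apply, smul_eq_mul,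
    Finsupp.finsetSum_apply]
  linarith

end Coprime

/-! ### The gap property -/

/-- Each value of `c` is the value at `⊤` or at least `q` times that value. -/
def GapBound {M : Type*} [Group M] (q : ℕ) (c : Subgroup M → ℕ) : Prop :=
  ∀ A, c A = c ⊤ ∨ q * c ⊤ ≤ c A

lemma GapBound.mul {M : Type*} [Group M] {q : ℕ} (hq : 1 ≤ q) {c d : Subgroup M → ℕ}
    (hc : GapBound q c) (hd : GapBound q d) : GapBound q fun A => c A * d A := by
  intro A
  have hcle : ∀ {e : Subgroup M → ℕ}, GapBound q e → e ⊤ ≤ e A := fun {e} he => by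
    rcases he A with h | h
    · exact h.ge
    · exact (Nat.le_mul_of_pos_left _ hq).trans h
  rcases hc A with h1 | h1
  · rcases hd A with h2 | h2
    · left
      simp only [h1, h2]
    · right
      calc q * (c ⊤ * d ⊤) = c ⊤ * (q * d ⊤) := by ring
        _ ≤ _ := Nat.mul_le_mul (hcle hc) h2
  · right
    calc q * (c ⊤ * d ⊤) = (q * c ⊤) * d ⊤ := by ring
        _ ≤ _ := Nat.mul_le_mul h1 (hcle hd)

lemma GapBound.of_mul_right {M : Type*} [Group M] {q : ℕ} {c : Subgroup M → ℕ} {d : ℕ} (hd : d ≠ 0)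
    (h : GapBound q fun A => c A * d) : GapBound q c := by
  intro A
  rcases h A with h | h
  · exact Or.inl (Nat.eq_of_mul_eq_mul_right (Nat.pos_of_ne_zero hd) h)
  · refine Or.inr (Nat.le_of_mul_le_mul_right (c := d) ?_ (Nat.pos_of_ne_zero hd))
    rw [mul_assoc]
    exact h

lemma gapBound_of_coprime {M K : Type*} [Group M] [Group K] [MulDistribMulAction M K] {p q : ℕ}
    [Fact p.Prime] (hq : ∀ m, IsPrimePow m → m ≡ 1 [MOD p] → q ≤ m) (hM : IsPGroup p M) [Finite K]
    (hp : ¬ p ∣ Nat.card K) :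
    GapBound q fun A : Subgroup M => Nat.card (fixedSubgroup K A) := by
  intro A
  dsimp only
  set a := Nat.card (fixedSubgroup K A) with ha
  set b := Nat.card (fixedSubgroup K (⊤ : Subgroup M)) with hb
  have ha0 : a ≠ 0 := Nat.card_pos.ne'
  have hb0 : b ≠ 0 := Nat.card_pos.ne'
  obtain ⟨d, hd⟩ : b ∣ a := Subgroup.card_dvd_of_le (fixedSubgroup_anti le_top)
  rcases eq_or_ne d 1 with h1 | h1
  · exact Or.inl (by rw [hd, h1, mul_one])
  have hd0 : d ≠ 0 := by
    rintro rfl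
    exact ha0 (by simpa using hd)
  right
  obtain ⟨r, hr, hrd⟩ := Nat.exists_prime_and_dvd h1
  have : Fact r.Prime := ⟨hr⟩
  obtain ⟨R, hR⟩ := exists_invariant_sylow hM hp r
  have hinv : ∀ (m : M), ∀ k ∈ (R : Subgroup K), m • k ∈ (R : Subgroup K) :=
    fun m k hk => smul_mem_of_sylow_smul_eq (hR m) hk
  let _ := restrictedAction M (R : Subgroup K) hinv
  have hmod : ∀ B : Subgroup M, Nat.card R ≡
      r ^ (Nat.card (fixedSubgroup K B)).factorization r [MOD p] := by
    intro B
    have := card_fixedSubgroup_modEq (K := (R : Subgroup K)) (hM.to_subgroup B)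
    rwa [card_fixedSubgroup_restricted (R : Subgroup K) hinv,
      card_sylow_inf_fixedSubgroup hM hp hR] at this
  -- The `r`-parts of `a` and `b` are both congruent to `|R|` modulo `p`, so the `r`-part of `d = a
  -- / b` is a prime power congruent to 1.
  have h2 := (hmod ⊤).symm.trans (hmod A)
  rw [← ha, ← hb, hd, Nat.factorization_mul hb0 hd0, Finsupp.coe_add, Pi.add_apply, pow_add] at h2
  have hcop : Nat.Coprime p (r ^ b.factorization r) := by
    rw [(Fact.out : p.Prime).coprime_iff_not_dvd]
    exact fun h => hp (h.trans ((Nat.ordProj_dvd b r).trans (Subgroup.card_subgroup_dvd_card _)))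
  have h3 : r ^ d.factorization r ≡ 1 [MOD p] := by
    refine Nat.ModEq.cancel_left_of_coprime hcop ?_
    rw [mul_one]
    exact h2.symm
  have hpos : 0 < d.factorization r := hr.factorization_pos_of_dvd hd0 hrd
  have h4 : q ≤ d := (hq _ (hr.isPrimePow.pow hpos.ne') h3).trans
    (Nat.le_of_dvd (Nat.pos_of_ne_zero hd0) (Nat.ordProj_dvd d r))
  rw [hd, mul_comm]
  exact Nat.mul_le_mul_left b h4

/-! ### Counting Sylow subgroups above a `p`-subgroup -/

/-- The number of Sylow `p`-subgroups of `G` that contain the image of `A`. -/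
noncomputable def sylowCount {M G : Type*} [Group M] [Group G] (p : ℕ) (f : M →* G)
    (A : Subgroup M) : ℕ := Nat.card {Q : Sylow p G // A.map f ≤ Q}

lemma sylowCount_bot {M G : Type*} [Group M] [Group G] (p : ℕ) (f : M →* G) :
    sylowCount p f ⊥ = Nat.card (Sylow p G) := by
  refine Nat.card_congr (Equiv.subtypeUnivEquiv fun Q => ?_)
  rw [Subgroup.map_bot]
  exact bot_le

lemma mem_smul_sylow_iff {G : Type*} [Group G] {p : ℕ} {Q : Sylow p G} {g x : G} :
    x ∈ g • Q ↔ g⁻¹ * x * g ∈ Q := by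
  change x ∈ ((g • Q : Sylow p G) : Subgroup G) ↔ _
  rw [Sylow.coe_subgroup_smul, Subgroup.mem_pointwise_smul_iff_inv_smul_mem]
  simp only [MulAut.smul_def, ← map_inv, MulAut.conj_apply, inv_inv]
  exact Iff.rfl

section Quotient

variable {M G : Type*} [Group M] [Group G] [Finite G] {p : ℕ} [Fact p.Prime]

/-- The Sylow subgroups of a quotient that contain a given subgroup, as images. -/
noncomputable def sylowImage (K : Subgroup G) [K.Normal] (f : M →* G) (A : Subgroup M)
    (Q : {Q : Sylow p G // A.map f ≤ Q}) :
    {Q : Sylow p (G ⧸ K) // A.map ((QuotientGroup.mk' K).comp f) ≤ Q} :=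
  ⟨Q.1.mapSurjective (QuotientGroup.mk'_surjective K), by
    rw [Sylow.coe_mapSurjective, ← Subgroup.map_map]
    exact Subgroup.map_mono Q.2⟩

lemma sylowCount_quotient_of_isPGroup (K : Subgroup G) [K.Normal] (hK : IsPGroup p K) (f : M →* G)
    (A : Subgroup M) :
    sylowCount p f A = sylowCount p ((QuotientGroup.mk' K).comp f) A := by
  have hle : ∀ Q : Sylow p G, K ≤ Q := fun Q => hK.le_sylow_of_normal Q
  have hcomap : ∀ Q : Sylow p G,
      ((Q : Subgroup G).map (QuotientGroup.mk' K)).comap (QuotientGroup.mk' K) = Q := fun Q => by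
    rw [Subgroup.comap_map_eq_self]
    rw [QuotientGroup.ker_mk']
    exact hle Q
  refine Nat.card_congr (Equiv.ofBijective (sylowImage K f A) ⟨fun Q R h => ?_, fun Q => ?_⟩)
  · have h1 : (Q.1 : Subgroup G).map (QuotientGroup.mk' K) =
        (R.1 : Subgroup G).map (QuotientGroup.mk' K) := by
      have := congrArg (fun x => (x.1 : Subgroup (G ⧸ K))) h
      simpa [sylowImage] using this
    refine Subtype.ext (Sylow.ext ?_)
    rw [← hcomap Q.1, h1, hcomap]
  · obtain ⟨R, hR⟩ := Sylow.mapSurjective_surjective (QuotientGroup.mk'_surjective K) p Q.1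
    refine ⟨⟨R, ?_⟩, Subtype.ext hR⟩
    rw [← hcomap R, ← Sylow.coe_mapSurjective (QuotientGroup.mk'_surjective K), hR,
      ← Subgroup.map_le_iff_le_comap, Subgroup.map_map]
    exact Q.2

/-- The commutator of `k` and `a` lies in `Q ⊓ K`, which is trivial. -/
lemma mul_comm_of_conj_mem {K : Subgroup G} [K.Normal] (hp : ¬ p ∣ Nat.card K) (Q : Sylow p G)
    {a k : G} (ha : a ∈ Q) (hk : k ∈ K) (h : k * a * k⁻¹ ∈ Q) : k * a = a * k := by
  obtain ⟨n, hn⟩ := IsPGroup.iff_card.mp Q.isPGroup'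
  have hbot : (Q : Subgroup G) ⊓ K = ⊥ := by
    refine (Subgroup.disjoint_of_coprime_natCard ?_).eq_bot
    rw [hn]
    exact Nat.Coprime.pow_left n (((Fact.out : p.Prime).coprime_iff_not_dvd).2 hp)
  have h1 : k * a * k⁻¹ * a⁻¹ ∈ (Q : Subgroup G) ⊓ K := by
    refine ⟨Q.mul_mem h (Q.inv_mem ha), ?_⟩
    have := K.mul_mem hk (‹K.Normal›.conj_mem _ (K.inv_mem hk) a)
    simpa [mul_assoc] using this
  rw [hbot, Subgroup.mem_bot, mul_inv_eq_one, mul_inv_eq_iff_eq_mul] at h1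
  exact h1

lemma mapSurjective_smul {G' : Type*} [Group G'] {f : G →* G'} (hf : Function.Surjective f)
    (g : G) (Q : Sylow p G) : (g • Q).mapSurjective hf = f g • Q.mapSurjective hf := by
  refine Sylow.ext ?_
  rw [Sylow.coe_subgroup_smul, Sylow.coe_mapSurjective, Sylow.coe_mapSurjective,
    Sylow.coe_subgroup_smul]
  ext x
  simp only [Subgroup.mem_map, Subgroup.mem_smul_pointwise_iff_exists, MulAut.smul_def,
    MulAut.conj_apply]
  constructor
  · rintro ⟨_, ⟨y, hy, rfl⟩, rfl⟩
    exact ⟨f y, ⟨y, hy, rfl⟩, by simp⟩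
  · rintro ⟨_, ⟨y, hy, rfl⟩, rfl⟩
    exact ⟨_, ⟨y, hy, rfl⟩, by simp⟩

/-- A `p`-subgroup of a subgroup `L` that contains a Sylow `p`-subgroup `Q` of the whole group is
contained in an `L`-conjugate of `Q`. -/
lemma exists_le_smul_sylow {L B : Subgroup G} (hB : IsPGroup p B) (hBL : B ≤ L) {Q : Sylow p G}
    (hQ : (Q : Subgroup G) ≤ L) : ∃ l ∈ L, B ≤ (l • Q : Sylow p G) := by
  obtain ⟨S, hS⟩ := (show IsPGroup p (B.subgroupOf L) from hB.comap_subtype).exists_le_sylow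
  obtain ⟨l, hl⟩ := MulAction.exists_smul_eq L (Q.subtype hQ) S
  refine ⟨l, l.2, fun b hb => ?_⟩
  have h : (⟨b, hBL hb⟩ : L) ∈ S := hS (show (⟨b, hBL hb⟩ : L) ∈ B.subgroupOf L from hb)
  rw [← hl, mem_smul_sylow_iff] at h
  exact mem_smul_sylow_iff.mpr h

lemma sylowImage_surjective (K : Subgroup G) [K.Normal] (hM : IsPGroup p M) (f : M →* G)
    (A : Subgroup M) : Function.Surjective (sylowImage (p := p) K f A) := by
  intro Q
  obtain ⟨R, hR⟩ := Sylow.mapSurjective_surjective (QuotientGroup.mk'_surjective K) p Q.1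
  have hRQ : (R : Subgroup G) ≤ (Q.1 : Subgroup (G ⧸ K)).comap (QuotientGroup.mk' K) := by
    rw [← hR, ← Subgroup.map_le_iff_le_comap]
    rfl
  obtain ⟨l, hl, hle⟩ := exists_le_smul_sylow ((hM.to_subgroup A).map f)
    (Subgroup.map_le_iff_le_comap.mp (by rw [Subgroup.map_map]; exact Q.2)) hRQ
  refine ⟨⟨l • R, hle⟩, Subtype.ext ?_⟩
  change (l • R).mapSurjective (QuotientGroup.mk'_surjective K) = _
  rw [mapSurjective_smul, hR]
  refine Sylow.smul_eq_iff_mem_normalizer.mpr ?_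
  exact Subgroup.le_normalizer hl

/-- Both subgroups are Sylow in `KQ`, so an element of `KQ` conjugates one to the other, and its
factor in `Q` can be dropped. -/
lemma exists_smul_eq_of_mapSurjective_eq {K : Subgroup G} [K.Normal] {Q R : Sylow p G}
    (h : Q.mapSurjective (QuotientGroup.mk'_surjective K) =
      R.mapSurjective (QuotientGroup.mk'_surjective K)) : ∃ k ∈ K, k • Q = R := by
  have h' : (R : Subgroup G) ≤ K ⊔ Q := by
    have := congrArg (fun x : Sylow p (G ⧸ K) => (x : Subgroup (G ⧸ K))) h
    simp only [Sylow.coe_mapSurjective] at this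
    have h1 := Subgroup.map_le_iff_le_comap.mp this.ge
    rwa [Subgroup.comap_map_eq, QuotientGroup.ker_mk', sup_comm] at h1
  obtain ⟨l, hl, hle⟩ := exists_le_smul_sylow R.isPGroup' h' (Q := Q) le_sup_right
  obtain ⟨k, hk, x, hx, rfl⟩ := Subgroup.mem_sup_of_normal_left.mp hl
  refine ⟨k, hk, ?_⟩
  have hxQ : x • Q = Q := Sylow.smul_eq_iff_mem_normalizer.mpr (Subgroup.le_normalizer hx)
  rw [mul_smul, hxQ] at hle
  exact Sylow.ext (R.is_maximal' (k • Q).isPGroup' hle)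

/-- The action of `M` by conjugation through `f` on a normal subgroup. -/
@[reducible] noncomputable def conjugationAction (K : Subgroup G) [K.Normal] (f : M →* G) :
    MulDistribMulAction M K :=
  MulDistribMulAction.compHom K ((MulAut.conjNormal (H := K)).comp f)

/-- Each fibre of the map to the Sylow subgroups of `G ⧸ K` containing the image of `A` is one orbit
of `C_K(A)`. All point stabilizers have the same order `d = |N_K(P)|`. -/
lemma exists_sylowCount_mul_eq (K : Subgroup G) [K.Normal] (hp : ¬ p ∣ Nat.card K)
    (hM : IsPGroup p M) (f : M →* G) :
    letI := conjugationAction K f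
    ∃ d ≠ 0, ∀ A : Subgroup M, sylowCount p f A * d =
      sylowCount p ((QuotientGroup.mk' K).comp f) A * Nat.card (fixedSubgroup K A) := by
  let _ := conjugationAction K f
  have hsmul : ∀ (m : M) (k : K), ((m • k : K) : G) = f m * k * (f m)⁻¹ := fun m k => rfl
  let P : Sylow p G := default
  refine ⟨Nat.card (MulAction.stabilizer K P), Nat.card_pos.ne', fun A => ?_⟩
  set F := fixedSubgroup K A with hF
  -- An element of `K` normalizing `Q` centralizes `Q`, hence `A`, so the stabilizer in `F` is the
  -- whole of `N_K(Q)`, a conjugate of `N_K(P)`.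
  have hstab : ∀ Q : Sylow p G, A.map f ≤ Q →
      Nat.card (MulAction.stabilizer F Q) = Nat.card (MulAction.stabilizer K P) := by
    intro Q hAQ
    obtain ⟨g, rfl⟩ := MulAction.exists_smul_eq G P Q
    have hfix : ∀ k : K, k • (g • P) = g • P → k ∈ F := by
      intro k hk a ha
      refine Subtype.ext ?_
      rw [hsmul, mul_inv_eq_iff_eq_mul]
      have haQ : f a ∈ g • P := hAQ ⟨a, ha, rfl⟩
      refine (mul_comm_of_conj_mem hp (g • P) haQ k.2 ?_).symm
      have hk : (k : G) • (g • P) = g • P := hk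
      rw [← hk, mem_smul_sylow_iff]
      simpa [mul_assoc] using haQ
    have hconj : ∀ k : K, (MulAut.conjNormal g k) • (g • P) = g • (k • P) := by
      intro k
      change ((MulAut.conjNormal g k : K) : G) • (g • P) = g • ((k : G) • P)
      rw [MulAut.conjNormal_apply, smul_smul, smul_smul]
      simp
    refine (Nat.card_congr (Equiv.ofBijective
      (fun k : MulAction.stabilizer K P => (⟨⟨MulAut.conjNormal g k, hfix _ ?_⟩, ?_⟩ :
        MulAction.stabilizer F (g • P))) ⟨?_, ?_⟩)).symm
    · rw [hconj, k.2]
    · change (MulAut.conjNormal g (k : K)) • (g • P) = g • P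
      rw [hconj, k.2]
    · intro k l h
      have := congrArg (fun x => (x.1.1 : K)) h
      exact Subtype.ext ((MulAut.conjNormal g).injective this)
    · rintro ⟨⟨k, hk⟩, hkP⟩
      have hk' : k • (g • P) = g • P := hkP
      refine ⟨⟨(MulAut.conjNormal g).symm k, ?_⟩, Subtype.ext (Subtype.ext (by simp))⟩
      have := hconj ((MulAut.conjNormal g).symm k)
      rw [MulEquiv.apply_symm_apply, hk'] at this
      exact (MulAction.injective g this).symm
  have hfiber : ∀ y, Nat.card {Q // sylowImage (p := p) K f A Q = y} *
      Nat.card (MulAction.stabilizer K P) = Nat.card F := by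
    intro y
    obtain ⟨Q, rfl⟩ := sylowImage_surjective K hM f A y
    have horb : Nat.card {R // sylowImage (p := p) K f A R = sylowImage K f A Q} =
        Nat.card (MulAction.orbit F Q.1) := by
      refine Nat.card_congr (Equiv.ofBijective (fun R => ⟨R.1.1, ?_⟩) ⟨?_, ?_⟩)
      · obtain ⟨k, hk, hkR⟩ := exists_smul_eq_of_mapSurjective_eq (congrArg Subtype.val R.2).symm
        refine ⟨⟨⟨k, hk⟩, fun a ha => Subtype.ext ?_⟩, hkR⟩
        rw [hsmul, mul_inv_eq_iff_eq_mul]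
        have h1 : f a ∈ Q.1 := Q.2 ⟨a, ha, rfl⟩
        have h2 : f a ∈ R.1.1 := R.1.2 ⟨a, ha, rfl⟩
        rw [← hkR, mem_smul_sylow_iff] at h2
        have h3 := mul_comm_of_conj_mem hp Q.1 h1 (K.inv_mem hk) (by simpa using h2)
        rw [inv_mul_eq_iff_eq_mul, ← mul_assoc, eq_mul_inv_iff_mul_eq] at h3
        exact h3
      · intro R S h
        have h' : R.1.1 = S.1.1 := congrArg (fun x => x.1) h
        exact Subtype.ext (Subtype.ext h')
      · rintro ⟨_, k, rfl⟩
        have hk : ∀ a ∈ A, f a * ((k : K) : G) = ((k : K) : G) * f a := fun a ha => by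
          have := congrArg Subtype.val (k.2 a ha)
          rwa [hsmul, mul_inv_eq_iff_eq_mul] at this
        refine ⟨⟨⟨((k : K) : G) • Q.1, ?_⟩, Subtype.ext ?_⟩, rfl⟩
        · rintro _ ⟨a, ha, rfl⟩
          have h1 : f a ∈ Q.1 := Q.2 ⟨a, ha, rfl⟩
          change f a ∈ ((k : K) : G) • Q.1
          rw [mem_smul_sylow_iff, mul_assoc, hk a ha, inv_mul_cancel_left]
          exact h1
        · change (((k : K) : G) • Q.1).mapSurjective (QuotientGroup.mk'_surjective K) =
            Q.1.mapSurjective (QuotientGroup.mk'_surjective K)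
          rw [mapSurjective_smul]
          have : QuotientGroup.mk' K ((k : K) : G) = 1 := by simp
          rw [this, one_smul]
    rw [horb, ← hstab Q.1 Q.2]
    rw [← Nat.card_prod]
    exact Nat.card_congr (MulAction.orbitProdStabilizerEquivGroup F Q.1)
  let _ := Fintype.ofFinite {Q : Sylow p (G ⧸ K) // A.map ((QuotientGroup.mk' K).comp f) ≤ Q}
  rw [sylowCount, ← Nat.card_congr (Equiv.sigmaFiberEquiv (sylowImage (p := p) K f A)),
    Nat.card_sigma, Finset.sum_mul, Finset.sum_congr rfl fun y _ => hfiber y, Finset.sum_const,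
    smul_eq_mul, Finset.card_univ, ← Nat.card_eq_fintype_card]
  rfl

end Quotient

/-- Induction on the length of the series, factoring out its first term `H 1`. The group `G` varies
while `M` stays fixed, so `f` need not remain injective. -/
lemma sylowCount_bounds {M : Type*} [Group M] [Finite M] {p q : ℕ} [Fact p.Prime] (hq1 : 1 ≤ q)
    (hq : ∀ m, IsPrimePow m → m ≡ 1 [MOD p] → q ≤ m) (hM : IsPGroup p M) (n : ℕ) :
    ∀ (G : Type u) [Group G] [Finite G] (H : ℕ → Subgroup G) (f : M →* G),
      H 0 = ⊥ → H n = ⊤ → (∀ i ≤ n, (H i).Normal) →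
      (∀ i < n, H i ≤ H (i + 1) ∧ ((∃ k : ℕ, (H i).relIndex (H (i + 1)) = p ^ k) ∨
        ((H i).relIndex (H (i + 1))).Coprime p)) →
      IndependentBound (sylowCount p f) ∧ GapBound q (sylowCount p f) := by
  induction n with
  | zero =>
    intro G _ _ H f h0 h1 _ _
    have hs : Subsingleton G := by
      have h : (⊥ : Subgroup G) = ⊤ := h0.symm.trans h1
      exact Subgroup.subsingleton_iff.mp (subsingleton_of_bot_eq_top h)
    have hone : ∀ A, sylowCount p f A = 1 := by
      intro A
      have : Subsingleton (Sylow p G) := ⟨fun Q R => Sylow.ext (Subsingleton.elim _ _)⟩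
      have : Nonempty {Q : Sylow p G // A.map f ≤ Q} := ⟨⟨default, (Subsingleton.elim _ _).le⟩⟩
      exact Nat.card_unique
    refine ⟨fun I _ _ => by simp [hone], fun A => by simp [hone]⟩
  | succ n ih =>
    intro G _ _ H f h0 h1 hn hs
    have : (H 1).Normal := hn 1 (by omega)
    set K := H 1 with hK
    have hmono : ∀ i ≤ n, K ≤ H (i + 1) := by
      intro i
      induction i with
      | zero => intro _; exact le_rfl
      | succ i ih => intro hi; exact (ih (by omega)).trans (hs (i + 1) (by omega)).1
    have hsurj := QuotientGroup.mk'_surjective K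
    obtain ⟨b1, b2⟩ := ih (G ⧸ K) (fun i => (H (i + 1)).map (QuotientGroup.mk' K))
      ((QuotientGroup.mk' K).comp f)
      (by
        rw [zero_add, ← hK, Subgroup.map_eq_bot_iff, QuotientGroup.ker_mk'])
      (by rw [h1, Subgroup.map_top_of_surjective _ hsurj])
      (fun i hi => (hn (i + 1) (by omega)).map _ hsurj)
      (fun i hi => by
        have hi' := hs (i + 1) (by omega)
        refine ⟨Subgroup.map_mono hi'.1, ?_⟩
        rw [Subgroup.relIndex_map_map, QuotientGroup.ker_mk', sup_eq_left.mpr (hmono i (by omega)),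
          sup_eq_left.mpr (hmono (i + 1) (by omega))]
        exact hi'.2)
    have hc := (hs 0 (by omega)).2
    rw [h0, zero_add, ← hK, Subgroup.relIndex_bot_left] at hc
    rcases hc with ⟨k, hk⟩ | hc
    · have e : sylowCount p f = sylowCount p ((QuotientGroup.mk' K).comp f) :=
        funext fun A => sylowCount_quotient_of_isPGroup K (IsPGroup.of_card hk) f A
      rw [e]
      exact ⟨b1, b2⟩
    · have hp : ¬ p ∣ Nat.card K := ((Fact.out : p.Prime).coprime_iff_not_dvd).1 hc.symm
      let _ := conjugationAction K f
      obtain ⟨d, hd, hA⟩ := exists_sylowCount_mul_eq K hp hM f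
      have e : (fun A => sylowCount p f A * d) = fun A =>
          sylowCount p ((QuotientGroup.mk' K).comp f) A * Nat.card (fixedSubgroup K A) := funext hA
      refine ⟨.of_mul_right hd ?_, .of_mul_right hd ?_⟩
      · rw [e]
        exact b1.mul (independentBound_of_coprime hM hp)
      · rw [e]
        exact b2.mul hq1 (gapBound_of_coprime hq hM hp)

/-! ### Maximal subgroups and the lower bound -/

/-- A noncyclic `p`-group has more than `p` maximal subgroups. -/
lemma lt_card_coatoms {M : Type*} [Group M] [Finite M] {p : ℕ} [Fact p.Prime] (hM : IsPGroup p M)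
    (hc : ∀ x : M, Subgroup.zpowers x ≠ ⊤) (I : Finset (Subgroup M)) (hI : ∀ A, A ∈ I ↔ IsCoatom A) :
    p < I.card := by
  classical
  let _ := Fintype.ofFinite M
  have hp := (Fact.out : p.Prime).two_le
  have hcard : ∀ A ∈ I, p * Nat.card A ≤ Nat.card M := by
    intro A hA
    obtain ⟨n, hn⟩ := hM.index A
    have h1 : A.index ≠ 1 := fun h => ((hI A).mp hA).1 (Subgroup.index_eq_one.mp h)
    have hn0 : n ≠ 0 := by
      rintro rfl
      exact h1 (by simpa using hn)
    have hpi : p ≤ A.index := hn ▸ Nat.le_self_pow hn0 p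
    rw [← A.card_mul_index, mul_comm]
    exact Nat.mul_le_mul_left _ hpi
  have hex : ∀ x : M, ∃ A ∈ I, x ∈ A := by
    intro x
    obtain ⟨A, hA, hx⟩ := (eq_top_or_exists_le_coatom (Subgroup.zpowers x)).resolve_left (hc x)
    exact ⟨A, (hI A).mpr hA, hx (Subgroup.mem_zpowers x)⟩
  have hcov : (Finset.univ : Finset M).erase 1 ⊆
      I.biUnion fun A => (Finset.univ.filter (· ∈ A)).erase 1 := by
    intro x hx
    obtain ⟨A, hA, hxA⟩ := hex x
    simp only [Finset.mem_biUnion, Finset.mem_erase, Finset.mem_filter, Finset.mem_univ, true_and]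
    exact ⟨A, hA, (Finset.mem_erase.mp hx).1, hxA⟩
  have h1 := (Finset.card_le_card hcov).trans Finset.card_biUnion_le
  rw [Finset.card_erase_of_mem (Finset.mem_univ _), Finset.card_univ, ← Nat.card_eq_fintype_card]
    at h1
  have h2 : ∀ A ∈ I, p * ((Finset.univ.filter (· ∈ A)).erase 1).card ≤ Nat.card M - p := by
    intro A hA
    rw [Finset.card_erase_of_mem (by simp [A.one_mem]), ← Fintype.card_subtype,
      ← Nat.card_eq_fintype_card, Nat.mul_sub, mul_one]
    exact Nat.sub_le_sub_right (hcard A hA) p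
  obtain ⟨A, hA, -⟩ := hex 1
  have hle : p ≤ Nat.card M :=
    (Nat.le_mul_of_pos_right p (Nat.card_pos (α := A))).trans (hcard A hA)
  -- With at most `p` maximal subgroups, covering the nonidentity elements gives `p(|M| - 1) ≤ p(|M|
  -- - p)`, which is absurd.
  by_contra! hlt
  have h3 := Nat.mul_le_mul_left p h1
  rw [Finset.mul_sum] at h3
  have h4 := h3.trans (Finset.sum_le_card_nsmul I _ _ h2)
  rw [smul_eq_mul] at h4
  have h5 := Nat.le_of_mul_le_mul_left (h4.trans (Nat.mul_le_mul_right _ hlt)) (by omega)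
  omega

theorem pow_le_card_sylow_of_isRedundantSylow {p q : ℕ} [Fact p.Prime]
    (hq : IsLeast {m : ℕ | IsPrimePow m ∧ m ≡ 1 [MOD p]} q) {G : Type u} [Group G] [Finite G]
    (hG : IsPSolvable p G) {P : Sylow p G} (hP : IsRedundantSylow P) :
    q ^ (p + 1) ≤ Nat.card (Sylow p G) := by
  classical
  obtain ⟨n, H, h0, h1, hn, hs⟩ := hG
  obtain ⟨M, ⟨hMP, hMu⟩, hmin⟩ := (Set.toFinite
    {M : Subgroup G | M ≤ P ∧ ∀ Q : Sylow p G, M ≤ Q → Q = P}).exists_minimal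
      ⟨P, le_rfl, fun Q hQ => Sylow.ext (P.is_maximal' Q.isPGroup' hQ)⟩
  have hM : IsPGroup p M := P.isPGroup'.to_le hMP
  obtain ⟨hW, hQ⟩ := sylowCount_bounds hq.1.1.one_lt.le (fun m h1 h2 => hq.2 ⟨h1, h2⟩) hM n G H
    M.subtype h0 h1 hn hs
  have htop : sylowCount p M.subtype ⊤ = 1 := by
    have hr : (⊤ : Subgroup M).map M.subtype = M := by
      rw [← MonoidHom.range_eq_map, Subgroup.range_subtype]
    rw [sylowCount, hr, Nat.card_eq_one_iff_unique]
    exact ⟨⟨fun Q R => Subtype.ext ((hMu Q.1 Q.2).trans (hMu R.1 R.2).symm)⟩, ⟨⟨P, hMP⟩⟩⟩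
  -- A generator of `M` would be a `p`-element, so redundancy would put all of `M` into a second
  -- Sylow subgroup.
  have hcyc : ∀ x : M, Subgroup.zpowers x ≠ ⊤ := by
    intro x hx
    obtain ⟨k, hk⟩ := IsPGroup.iff_orderOf.mp hM x
    obtain ⟨Q, hQP, hxQ⟩ := hP x ⟨k, by rw [Subgroup.orderOf_coe, hk]⟩
    refine hQP (hMu Q fun y hy => ?_)
    have hy' : (⟨y, hy⟩ : M) ∈ Subgroup.zpowers x := hx ▸ Subgroup.mem_top _
    obtain ⟨m, hm⟩ := Subgroup.mem_zpowers_iff.mp hy'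
    have : y = (x : G) ^ m := by
      have := congrArg Subtype.val hm
      simpa using this.symm
    rw [this]
    exact Q.zpow_mem hxQ m
  have hgap : ∀ A : Subgroup M, A ≠ ⊤ → q ≤ sylowCount p M.subtype A := by
    intro A hA
    have hAM : A.map M.subtype ≤ M := Subgroup.map_subtype_le A
    rcases hQ A with h | h
    · rw [htop, sylowCount, Nat.card_eq_one_iff_unique] at h
      have hu := h.1
      have : M ≤ A.map M.subtype := hmin ⟨hAM.trans hMP, fun Q hQ =>
        congrArg Subtype.val (Subsingleton.elim
          (⟨Q, hQ⟩ : {Q : Sylow p G // A.map M.subtype ≤ Q}) ⟨P, hAM.trans hMP⟩)⟩ hAM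
      refine absurd (eq_top_iff.mpr fun x _ => ?_) hA
      obtain ⟨y, hy, hyx⟩ := this x.2
      rwa [← Subtype.ext hyx]
    · rwa [htop, mul_one] at h
  let I : Finset (Subgroup M) := (Set.toFinite {A : Subgroup M | IsCoatom A}).toFinset
  have hI : ∀ A, A ∈ I ↔ IsCoatom A := fun A => by simp [I]
  have hnil : Group.IsNilpotent M := hM.isNilpotent
  have hdvd := hW I (fun A hA => Subgroup.NormalizerCondition.normal_of_coatom A
      Group.normalizerCondition_of_isNilpotent ((hI A).mp hA))
    (fun A hA B hB hAB => ((hI A).mp hA).sup_eq_top_of_ne ((hI B).mp hB) hAB)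
  rw [htop, one_pow, mul_one, mul_one, sylowCount_bot] at hdvd
  calc q ^ (p + 1) ≤ q ^ I.card := Nat.pow_le_pow_right hq.1.1.pos (lt_card_coatoms hM hcyc I hI)
    _ ≤ ∏ A ∈ I, sylowCount p M.subtype A := by
      rw [← Finset.prod_const]
      exact Finset.prod_le_prod' fun A hA => hgap A ((hI A).mp hA).1
    _ ≤ Nat.card (Sylow p G) := Nat.le_of_dvd Nat.card_pos hdvd

/-! ### The extremal example -/

lemma card_multiplicative_pi {ι F : Type*} [Fintype ι] :
    Nat.card (Multiplicative (ι → F)) = Nat.card F ^ Fintype.card ι := by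
  rw [Nat.card_congr Multiplicative.toAdd, Nat.card_fun, Nat.card_eq_fintype_card (α := ι)]

section Diagonal

variable {ι F E : Type*} [Field F] [Group E]

/-- The diagonal action on `ι → F` given by a family of characters. -/
def diagonalAction (χ : ι → E →* Fˣ) : E →* MulAut (Multiplicative (ι → F)) where
  toFun e :=
    { toFun := fun v => .ofAdd fun i => (χ i e : F) * v.toAdd i
      invFun := fun v => .ofAdd fun i => ((χ i e)⁻¹ : Fˣ) * v.toAdd i
      left_inv := fun v => by simp
      right_inv := fun v => by simp
      map_mul' := fun v w => by
        apply Multiplicative.toAdd.injective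
        funext i
        simp [mul_add] }
  map_one' := by
    ext v : 1
    simp
  map_mul' a b := by
    ext v : 1
    simp [mul_assoc]

lemma diagonalAction_apply (χ : ι → E →* Fˣ) (e : E) (v : Multiplicative (ι → F)) (i : ι) :
    (diagonalAction χ e v).toAdd i = (χ i e : F) * v.toAdd i := rfl

variable [Fintype ι] [Finite F] [Finite E] {p : ℕ} [Fact p.Prime]

instance finite_semidirectProduct {N H : Type*} [Group N] [Group H] [Finite N] [Finite H]
    (φ : H →* MulAut N) : Finite (N ⋊[φ] H) :=
  Finite.of_equiv _ SemidirectProduct.equivProd.symm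

lemma isPSolvable_semidirectProduct {N H : Type*} [Group N] [Group H]
    (hH : IsPGroup p H) [Finite H] (hN : (Nat.card N).Coprime p) (φ : H →* MulAut N) :
    IsPSolvable p (N ⋊[φ] H) := by
  set K : Subgroup (N ⋊[φ] H) := (SemidirectProduct.inl : N →* N ⋊[φ] H).range with hK
  have hKn : K.Normal := by
    rw [hK, SemidirectProduct.range_inl_eq_ker_rightHom]
    infer_instance
  refine ⟨2, fun i => if i = 0 then ⊥ else if i = 1 then K else ⊤, by simp, by simp, ?_, ?_⟩
  · intro i _
    dsimp only
    split_ifs <;> infer_instance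
  · intro i hi
    interval_cases i
    · refine ⟨by simp, Or.inr ?_⟩
      simp only [if_true, zero_add, one_ne_zero, if_false, Subgroup.relIndex_bot_left]
      rwa [← Nat.card_congr (MonoidHom.ofInjective SemidirectProduct.inl_injective).toEquiv]
    · refine ⟨by simp, Or.inl ?_⟩
      obtain ⟨n, hn⟩ := IsPGroup.iff_card.mp hH
      refine ⟨n, ?_⟩
      simp only [one_ne_zero, if_true, if_false, one_add_one_eq_two, OfNat.ofNat_ne_zero,
        OfNat.ofNat_ne_one, Subgroup.relIndex_top_right]
      rw [hK, SemidirectProduct.range_inl_eq_ker_rightHom, Subgroup.index_ker,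
        MonoidHom.range_eq_top.mpr SemidirectProduct.rightHom_surjective, Subgroup.card_top, hn]

lemma exists_isRedundantSylow_diagonal (hE : IsPGroup p E) (hF : ¬ p ∣ Nat.card F)
    (χ : ι → E →* Fˣ) (h1 : ∀ e, ∃ i, χ i e = 1) (h2 : ∀ i, ∃ e, χ i e ≠ 1) :
    (∃ P : Sylow p (Multiplicative (ι → F) ⋊[diagonalAction χ] E), IsRedundantSylow P) ∧
    Nat.card (Sylow p (Multiplicative (ι → F) ⋊[diagonalAction χ] E)) ≤
      Nat.card F ^ Fintype.card ι := by
  classical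
  set G := Multiplicative (ι → F) ⋊[diagonalAction χ] E
  set C : Subgroup G := (SemidirectProduct.inr : E →* G).range with hC
  have hcard : Nat.card C = Nat.card E :=
    (Nat.card_congr (MonoidHom.ofInjective SemidirectProduct.inr_injective).toEquiv).symm
  have hidx : C.index = Nat.card F ^ Fintype.card ι := by
    have h := C.card_mul_index
    rw [hcard, SemidirectProduct.card, card_multiplicative_pi, mul_comm] at h
    exact Nat.eq_of_mul_eq_mul_right Nat.card_pos h
  have hCp : IsPGroup p C := by
    obtain ⟨n, hn⟩ := IsPGroup.iff_card.mp hE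
    exact IsPGroup.of_card (hcard.trans hn)
  let P : Sylow p G := hCp.toSylow (by
    rw [hidx]
    exact fun h => hF ((Fact.out : p.Prime).dvd_of_dvd_pow h))
  refine ⟨⟨P, fun x hx => ?_⟩, ?_⟩
  · by_cases hxP : x ∈ P
    · obtain ⟨e, rfl⟩ : x ∈ C := hxP
      obtain ⟨i, hi⟩ := h1 e
      obtain ⟨e', he'⟩ := h2 i
      -- This basis vector commutes with `e`, so `e` also lies in the conjugate of `P` by `v`. That
      -- conjugate is not `P`, since `e'` moves `v`.
      set v : Multiplicative (ι → F) := .ofAdd (Pi.single i 1)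
      have hfix : diagonalAction χ e v = v := by
        apply Multiplicative.toAdd.injective
        funext j
        rw [diagonalAction_apply]
        by_cases hj : j = i
        · subst hj
          simp [hi]
        · simp [v, hj]
      have hcomm : (SemidirectProduct.inl v : G) * SemidirectProduct.inr e =
          SemidirectProduct.inr e * SemidirectProduct.inl v := by
        have := SemidirectProduct.inl_aut (φ := diagonalAction χ) e v
        rw [hfix, map_inv, eq_mul_inv_iff_mul_eq] at this
        exact this
      refine ⟨(SemidirectProduct.inl v : G) • P, fun h => ?_, ?_⟩
      · have hmem : (SemidirectProduct.inr e' : G) ∈ (SemidirectProduct.inl v : G) • P := by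
          rw [h]
          exact ⟨e', rfl⟩
        rw [mem_smul_sylow_iff] at hmem
        obtain ⟨e'', he''⟩ := hmem
        have h3 := congrArg (fun g : G => g.left.toAdd i) he''
        simp only [SemidirectProduct.left_inr, ← map_inv, SemidirectProduct.mul_left,
          SemidirectProduct.left_inl, SemidirectProduct.right_inl, SemidirectProduct.right_inr,
          SemidirectProduct.mul_right, map_one, mul_one, one_mul, toAdd_mul,
          toAdd_one, toAdd_inv, Pi.add_apply, Pi.neg_apply, Pi.zero_apply,
          diagonalAction_apply] at h3
        refine he' (Units.ext ?_)
        simp only [v, toAdd_ofAdd, Pi.single_eq_same, mul_one] at h3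
        rw [Units.val_one]
        linear_combination -h3
      · rw [mem_smul_sylow_iff, mul_assoc, ← hcomm, inv_mul_cancel_left]
        exact ⟨e, rfl⟩
    · obtain ⟨k, hk⟩ := hx
      obtain ⟨Q, hQ⟩ := (IsPGroup.of_card (p := p) (n := k)
        ((Nat.card_zpowers x).trans hk)).exists_le_sylow
      have hxQ : x ∈ Q := hQ (Subgroup.mem_zpowers x)
      exact ⟨Q, fun h => hxP (h ▸ hxQ), hxQ⟩
  · rw [← hidx]
    exact Nat.le_of_dvd (Nat.pos_of_ne_zero Subgroup.index_ne_zero_of_finite) P.card_dvd_index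

end Diagonal

/-- The characters of `U × U`, for `U` cyclic of order `p`, up to proportionality. -/
def planeCharacter {A : Type*} [CommGroup A] (U : Subgroup A) (p : ℕ) :
    Option (Fin p) → U × U →* A
  | none => U.subtype.comp (MonoidHom.snd U U)
  | some t => U.subtype.comp (MonoidHom.fst U U * MonoidHom.snd U U ^ (t : ℕ))

lemma exists_planeCharacter_eq_one {A : Type*} [CommGroup A] (U : Subgroup A) {p : ℕ}
    [Fact p.Prime] (hU : Nat.card U = p) (e : U × U) : ∃ i, planeCharacter U p i e = 1 := by
  obtain ⟨a, b⟩ := e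
  by_cases hb : b = 1
  · exact ⟨none, by simp [planeCharacter, hb]⟩
  -- Here `b` generates `U`, so `a⁻¹` is a power `b ^ n` and the character with `t = n % p` kills
  -- `(a, b)`.
  · obtain ⟨n, hn⟩ := Submonoid.mem_powers_iff _ _ |>.mp
      (mem_powers_of_prime_card (p := p) hU hb (g' := a⁻¹))
    refine ⟨some ⟨n % p, Nat.mod_lt _ (Fact.out : p.Prime).pos⟩, ?_⟩
    have : a * b ^ (n % p) = 1 := by
      have h := pow_mod_natCard (G := U) b n
      rw [hU] at h
      rw [h, hn, mul_inv_cancel]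
    exact congrArg Subtype.val this

lemma exists_planeCharacter_ne_one {A : Type*} [CommGroup A] (U : Subgroup A) {p : ℕ}
    [Fact p.Prime] (hU : Nat.card U = p) (i : Option (Fin p)) :
    ∃ e, planeCharacter U p i e ≠ 1 := by
  have : Finite U := Nat.finite_of_card_ne_zero (hU ▸ (Fact.out : p.Prime).ne_zero)
  have : Nontrivial U := Finite.one_lt_card_iff_nontrivial (α := U) |>.mp (by
    rw [hU]; exact (Fact.out : p.Prime).one_lt)
  obtain ⟨u, hu⟩ := exists_ne (1 : U)
  cases i with
  | none => exact ⟨(1, u), by simpa [planeCharacter] using hu⟩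
  | some t => exact ⟨(u, 1), by simpa [planeCharacter] using hu⟩

theorem mainTheorem3 (p : ℕ) [Fact p.Prime] (q : ℕ)
    (hq : IsLeast {m : ℕ | IsPrimePow m ∧ m ≡ 1 [MOD p]} q) :
    (∀ (G : Type u) [Group G] [Finite G], IsPSolvable p G →
      (∃ P : Sylow p G, IsRedundantSylow P) → q ^ (p + 1) ≤ Nat.card (Sylow p G)) ∧
    IsLeast {ν : ℕ | ∃ (G : Type u) (_ : Group G) (_ : Finite G), IsPSolvable p G ∧
      (∃ P : Sylow p G, IsRedundantSylow P) ∧ Nat.card (Sylow p G) = ν} (q ^ (p + 1)) := by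
  refine ⟨fun G _ _ hG ⟨P, hP⟩ => pow_le_card_sylow_of_isRedundantSylow hq hG hP, ?_, ?_⟩
  swap
  · rintro ν ⟨G, _, _, hG, ⟨P, hP⟩, rfl⟩
    exact pow_le_card_sylow_of_isRedundantSylow hq hG hP
  have hp := (Fact.out : p.Prime)
  obtain ⟨r, k, hr, hk, hrk⟩ := (isPrimePow_nat_iff q).mp hq.1.1
  have : Fact r.Prime := ⟨hr⟩
  -- The field of order `q`, lifted to the universe of the statement; it contains the `p`-th roots
  -- of unity because `p ∣ q - 1`.
  let F := ULift.{u} (GaloisField r k)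
  have : Finite F := Finite.of_equiv _ Equiv.ulift.symm
  have hF : Nat.card F = q := by
    rw [Nat.card_congr Equiv.ulift, GaloisField.card r k hk.ne', hrk]
  have hq1 : 1 ≤ q := hq.1.1.pos
  have hdvd : p ∣ q - 1 := (Nat.modEq_iff_dvd' hq1).mp hq.1.2.symm
  have hpq : ¬ p ∣ q := fun h => by
    have h1 : p ∣ q - (q - 1) := Nat.dvd_sub h hdvd
    rw [Nat.sub_sub_self hq1] at h1
    exact hp.one_lt.ne' (Nat.dvd_one.mp h1)
  obtain ⟨ζ, hζ⟩ := exists_prime_orderOf_dvd_card' (G := Fˣ) p (by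
    rwa [Nat.card_units, hF])
  set U : Subgroup Fˣ := Subgroup.zpowers ζ
  have hU : Nat.card U = p := (Nat.card_zpowers ζ).trans hζ
  have hE : IsPGroup p (U × U) := IsPGroup.of_card (n := 2) (by rw [Nat.card_prod, hU, sq])
  obtain ⟨hred, hle⟩ := exists_isRedundantSylow_diagonal hE (by rwa [hF]) (planeCharacter U p)
    (exists_planeCharacter_eq_one U hU) (exists_planeCharacter_ne_one U hU)
  rw [hF, Fintype.card_option, Fintype.card_fin] at hle
  have hsolv : IsPSolvable p (Multiplicative (Option (Fin p) → F) ⋊[diagonalAction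
      (planeCharacter U p)] (U × U)) := by
    refine isPSolvable_semidirectProduct hE ?_ _
    rw [card_multiplicative_pi, hF]
    exact Nat.Coprime.pow_left _ ((hp.coprime_iff_not_dvd.mpr hpq).symm)
  obtain ⟨P, hP⟩ := hred
  -- The complement has index `q ^ (p + 1)`, which bounds the count from above; the general lower
  -- bound forces equality.
  exact ⟨_, inferInstance, inferInstance, hsolv, ⟨P, hP⟩,
    le_antisymm hle (pow_le_card_sylow_of_isRedundantSylow hq hsolv hP)⟩
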